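/- Let $G$ be a Hausdorff locally compact abelian group (written additively) whose Pontryagin dual $\hat G$ is separable. A group compactification $(\iota_X,X)$ of $G$ is a compact Hausdorff topological group $X$ (necessarily abelian) with a continuous homomorphism $\iota_X:G\to X$ with dense range; $\mu_X$ is the normalized Haar measure of $X$, and $\mathfrak U_{(\iota_X,X)}$ is the filter on $G$ generated by the sets $\iota_X^{-1}(U)$, $U$ a neighbourhood of $0$ in $X$. Let $(\iota_b,bG)$ be the Bohr compactification, i.e. the maximal group compactification of $G$, which covers every other one. A function on $X$ is Riemann integrable if it is bounded and its set of discontinuities is $\mu_X$-null. A Riemann integrable $\phi^*$ on $X$ realizes $\phi:G\to\mathbb C$ if $\phi=\phi^*\circ\iota_X$. The set $\mathcal H(G)$ of Hartman measurable functions consists of all $\phi:G\to\mathbb C$ that have a realization on $bG$; a set $A\subseteq G$ is Hartman measurable if $A=\iota_b^{-1}(M)$ for some $M\subseteq bG$ with $\mu_{bG}(\partial M)=0$. Let $m_G$ be the invariant mean on Hartman measurable functions, $m_G(\phi)=\int_{bG}\phi^*\,d\mu_{bG}$ for any realization $\phi^*$ of $\phi$ on $bG$. For $\phi\in\mathcal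 H(G)$ put $d_\phi(g)=m_G(|\phi-\phi(g+\cdot)|)$, and let $\mathcal F(\phi)$ be the filter on $G$ generated by the sets $\{g\in G: d_\phi(g)<\varepsilon\}$, $\varepsilon>0$. For a Riemann integrable $\phi^*$ on a group compactification $Y$ put $d_{\phi^*}(x)=\int_Y|\phi^*(y)-\phi^*(x+y)|\,d\mu_Y(y)$; then $\ker d_{\phi^*}=\{x\in Y:d_{\phi^*}(x)=0\}$ is a subgroup of $Y$. Then the filters $\mathcal F(\phi)$, $\phi\in\mathcal H(G)$, are exactly the filters $\mathfrak U_{(\iota_X,X)}$ with $(\iota_X,X)$ a metrizable group compactification of $G$. More precisely: 1. If $\phi\in\mathcal H(G)$ and $\mathcal F(\phi)=\mathfrak U_{(\iota_X,X)}$ for a group compactification $(\iota_X,X)$, then $X$ is metrizable. 2. For every metrizable group compactification $(\iota_X,X)$ there is a Hartman measurable set $A\subseteq G$ with $\mathcal F(1_A)=\mathfrak U_{(\iota_X,X)}$. 3. If $\phi^*$ realizes $\phi$ on $bG$, then there is a metrizable group compactification $(\iota_X,X)$ with $\mathcal F(\phi)=\mathfrak U_{(\iota_X,X)}$ and a topological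 isomorphism $X\cong bG/\ker d_{\phi^*}$ carrying $\iota_X(g)$ to the class of $\iota_b(g)$ for every $g\in G$. 4. More generally, if $\phi^*$ realizes $\phi$ on any group compactification $(\iota_Y,Y)$, then $\phi\in\mathcal H(G)$, and the conclusion of 3 holds with $(\iota_Y,Y)$ in place of $(\iota_b,bG)$. -/

import Mathlib

open MeasureTheory Filter Topology TopologicalSpace

universe u v w

/-- The data making a fixed type `X` a group compactification of `G`: a compact Hausdorff
topological group structure on `X` and a continuous homomorphism from `G` to `X` with dense range.
(A Hausdorff group with a dense homomorphic image of an abelian group is abelian, so asking for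
commutativity of `X` is no restriction.) -/
structure CompactificationOn (G : Type u) [AddCommGroup G] [TopologicalSpace G] (X : Type v) where
  [addCommGroup : AddCommGroup X]
  [topologicalSpace : TopologicalSpace X]
  [isTopologicalAddGroup : IsTopologicalAddGroup X]
  [compactSpace : CompactSpace X]
  [t2Space : T2Space X]
  toHom : G →ₜ+ X
  denseRange : DenseRange toHom

/-- A group compactification `(ι_X, X)` of `G`. -/
structure GroupCompactification (G : Type u) [AddCommGroup G] [TopologicalSpace G] where
  carrier : Type v
  str : CompactificationOn G carrier

namespace GroupCompactification

section Basic

variable {G : Type u} [AddCommGroup G] [TopologicalSpace G]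

instance : CoeSort (GroupCompactification.{u, v} G) (Type v) := ⟨carrier⟩

variable (X : GroupCompactification.{u, v} G)

instance : AddCommGroup X := X.str.addCommGroup
instance : TopologicalSpace X := X.str.topologicalSpace
instance : IsTopologicalAddGroup X := X.str.isTopologicalAddGroup
instance : CompactSpace X := X.str.compactSpace
instance : T2Space X := X.str.t2Space
instance : MeasurableSpace X := borel X
instance : BorelSpace X := ⟨rfl⟩

/-- The homomorphism `ι_X : G → X`. -/
def ι : G →ₜ+ X := X.str.toHom

theorem denseRange_ι : DenseRange X.ι := X.str.denseRange

/-- The filter on `G` generated by the preimages under `ι_X` of the neighbourhoods of `0` in `X`. -/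
def nhdsFilter : Filter G := comap X.ι (𝓝 0)

/-- The normalized Haar measure of `X`. -/
noncomputable def haar : Measure X := Measure.addHaarMeasure ⊤

instance : IsProbabilityMeasure X.haar :=
  ⟨by simpa [haar] using Measure.addHaarMeasure_self (K₀ := (⊤ : PositiveCompacts X))⟩

instance : X.haar.IsAddHaarMeasure := by unfold haar; infer_instance

/-- Riemann integrable functions on `X`: bounded, with a Haar-null set of discontinuities. -/
def RiemannIntegrable {E : Type w} [NormedAddCommGroup E] (f : X → E) : Prop :=
  (∃ C : ℝ, ∀ x, ‖f x‖ ≤ C) ∧ X.haar {x | ¬ ContinuousAt f x} = 0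

/-- `f` is a realization of `φ` on `X`: `f` is Riemann integrable and `φ = f ∘ ι_X`. -/
def Realizes {E : Type w} [NormedAddCommGroup E] (f : X → E) (φ : G → E) : Prop :=
  X.RiemannIntegrable f ∧ φ = f ∘ X.ι

/-- `d_f (x) = ‖f - τ_x f‖₁ = ∫ |f - τ_x f| dμ_X`. -/
noncomputable def translationDist (f : X → ℂ) (x : X) : ℝ :=
  ∫ y, ‖f y - f (x + y)‖ ∂X.haar

variable {X}

theorem RiemannIntegrable.integrable {E : Type w} [NormedAddCommGroup E]
    [SecondCountableTopology E] {f : X → E} (hf : X.RiemannIntegrable f) : Integrable f X.haar := by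
  obtain ⟨⟨C, hC⟩, h0⟩ := hf
  have hm : MeasurableSet {x | ContinuousAt f x} :=
    (IsGδ.setOfPred_continuousAt f).measurableSet
  have hc : ContinuousOn f {x | ContinuousAt f x} := fun x hx => ContinuousAt.continuousWithinAt hx
  have hs := hc.aestronglyMeasurable (μ := X.haar) hm
  have hr : X.haar.restrict {x | ContinuousAt f x} = X.haar :=
    Measure.restrict_eq_self_of_ae_mem (by rw [ae_iff]; exact h0)
  rw [hr] at hs
  exact Integrable.of_bound hs C (Eventually.of_forall hC)

/-- `ker d_f = {x : ‖f - τ_x f‖₁ = 0}`, a subgroup of `X` when `f` is Riemann integrable. -/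
noncomputable def kerTranslationDist (f : X → ℂ) (hf : X.RiemannIntegrable f) : AddSubgroup X where
  carrier := {x | X.translationDist f x = 0}
  zero_mem' := by simp [translationDist]
  add_mem' := by
    intro a b ha hb
    have hi := hf.integrable
    have hab : ∀ c : X, Integrable (fun y => f (c + y)) X.haar := fun c => hi.comp_add_left c
    have e1 := (integral_eq_zero_iff_of_nonneg (fun _ => norm_nonneg _)
      (hi.sub (hab a)).norm).1 ha
    have e2 := (integral_eq_zero_iff_of_nonneg (fun _ => norm_nonneg _)
      (hi.sub (hab b)).norm).1 hb
    have e3 := (measurePreserving_add_left X.haar b).quasiMeasurePreserving.ae e1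
    have : (fun y => ‖f y - f (a + b + y)‖) =ᵐ[X.haar] 0 := by
      filter_upwards [e2, e3] with y h2 h3
      simp only [Pi.zero_apply, norm_eq_zero, sub_eq_zero, Pi.sub_apply] at h2 h3 ⊢
      rw [h2, h3, add_assoc]
    simpa [translationDist] using integral_congr_ae this
  neg_mem' := by
    intro a ha
    have : X.translationDist f (-a) = X.translationDist f a := by
      unfold translationDist
      rw [← integral_add_left_eq_self (μ := X.haar) (fun y => ‖f y - f (-a + y)‖) a]
      simp [norm_sub_rev]
    simpa [this] using ha

end Basic

section Bohr

variable (G : Type u) [AddCommGroup G] [TopologicalSpace G]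

/-- All group compactifications of `G` carried by a set of families of subsets of `G`. Up to
equivalence these are all group compactifications of `G`, see `exists_bohr_cover`. -/
structure BohrIndex where
  S : Set (Set (Set G))
  str : CompactificationOn G S

variable {G} in
/-- The compactification belonging to an index. -/
def BohrIndex.toCompactification (i : BohrIndex G) : GroupCompactification.{u, u} G := ⟨i.S, i.str⟩

/-- The diagonal homomorphism `g ↦ (ι_X g)_X` into the product of all group compactifications. -/
def bohrDiag : G →+ ((i : BohrIndex G) → i.toCompactification) where
  toFun g i := i.toCompactification.ι g
  map_zero' := by ext1 i; exact map_zero _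
  map_add' a b := by ext1 i; exact map_add _ a b

theorem continuous_bohrDiag : Continuous (bohrDiag G) :=
  continuous_pi fun i => i.toCompactification.ι.continuous_toFun

/-- The underlying group of `bG`: the closure of the image of the diagonal homomorphism. -/
abbrev BohrGroup : Type u := (bohrDiag G).range.topologicalClosure

/-- The Bohr compactification `(ι_b, bG)`, the maximal group compactification of `G`. -/
def bohr : GroupCompactification.{u, u} G where
  carrier := BohrGroup G
  str :=
    { compactSpace := isCompact_iff_compactSpace.1
        ((bohrDiag G).range.isClosed_topologicalClosure.isCompact)
      toHom :=
        { toFun g := ⟨bohrDiag G g, subset_closure ⟨g, rfl⟩⟩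
          map_zero' := Subtype.ext (map_zero _)
          map_add' a b := Subtype.ext (map_add _ a b)
          continuous_toFun := (continuous_bohrDiag G).subtype_mk _ }
      denseRange := by
        intro x
        rw [closure_subtype, ← Set.range_comp]
        exact x.2 }

variable {G}

/-- `(ι_b, bG)` is maximal: it covers every group compactification, in whatever universe. -/
theorem exists_bohr_cover (X : GroupCompactification.{u, v} G) :
    ∃ π : bohr G →ₜ+ X, ∀ g, π ((bohr G).ι g) = X.ι g := by
  let j : X → Set (Set G) := fun x => (comap X.ι (𝓝 x)).sets
  have hj : Function.Injective j := by
    intro x y hxy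
    by_contra hne
    have h : comap X.ι (𝓝 x) = comap X.ι (𝓝 y) := Filter.filter_eq hxy
    have hd : Disjoint (comap X.ι (𝓝 x)) (comap X.ι (𝓝 y)) :=
      disjoint_comap (disjoint_nhds_nhds.2 hne)
    rw [← h, disjoint_self] at hd
    have hn : (comap X.ι (𝓝 x)).NeBot := by
      refine comap_neBot_iff.2 fun t ht => ?_
      obtain ⟨_, hy, g, rfl⟩ := mem_closure_iff_nhds.1 (X.denseRange_ι x) t ht
      exact ⟨g, hy⟩
    exact hn.ne hd
  let e : Set.range j ≃ X := (Equiv.ofInjective j hj).symm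
  let _ : AddCommGroup (Set.range j) := e.addCommGroup
  let _ : TopologicalSpace (Set.range j) := TopologicalSpace.induced e inferInstance
  let a : Set.range j ≃+ X := e.addEquiv
  let h : Set.range j ≃ₜ X := e.toHomeomorphOfIsInducing ⟨rfl⟩
  let i : BohrIndex G :=
    { S := Set.range j
      str :=
        { isTopologicalAddGroup := topologicalAddGroup_induced a
          compactSpace := h.symm.compactSpace
          t2Space := h.symm.t2Space
          toHom :=
            { toFun g := a.symm (X.ι g)
              map_zero' := by simp
              map_add' := by simp
              continuous_toFun := h.symm.continuous.comp X.ι.continuous_toFun }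
          denseRange := h.symm.surjective.denseRange.comp X.denseRange_ι h.symm.continuous } }
  refine ⟨
    { toFun := fun x => a (x.1 i)
      map_zero' := map_zero a
      map_add' := fun x y => map_add a _ _
      continuous_toFun := h.continuous.comp ((continuous_apply i).comp continuous_subtype_val) },
    fun g => a.apply_symm_apply _⟩

end Bohr

end GroupCompactification

section Hartman

variable {G : Type u} [AddCommGroup G] [TopologicalSpace G]

open GroupCompactification

/-- Hartman measurable functions: those with a Riemann integrable extension to `bG`. -/
def IsHartman {E : Type w} [NormedAddCommGroup E] (φ : G → E) : Prop :=
  ∃ f : bohr G → E, (bohr G).Realizes f φ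

/-- Hartman measurable sets: preimages of continuity sets of `bG`. -/
def IsHartmanSet (A : Set G) : Prop :=
  ∃ M : Set (bohr G), (bohr G).haar (frontier M) = 0 ∧ A = (bohr G).ι ⁻¹' M

open Classical in
/-- The invariant mean `m_G` on Hartman measurable functions: the Haar integral over `bG` of a
realization, whichever it is (see `hartmanMean_eq`). -/
noncomputable def hartmanMean (φ : G → ℝ) : ℝ :=
  if h : IsHartman φ then ∫ x, h.choose x ∂(bohr G).haar else 0

theorem hartmanMean_eq {φ : G → ℝ} {f : bohr G → ℝ} (hf : (bohr G).Realizes f φ) :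
    hartmanMean φ = ∫ x, f x ∂(bohr G).haar := by
  have h : IsHartman φ := ⟨f, hf⟩
  rw [hartmanMean, dif_pos h]
  have hc := h.choose_spec
  refine integral_congr_ae ?_
  filter_upwards [ae_iff.2 hf.1.2, ae_iff.2 hc.1.2] with x hx hx'
  by_contra hne
  have ho : ∀ᶠ y in 𝓝 x, h.choose y ≠ f y :=
    (hx'.tendsto.prodMk_nhds hx.tendsto).eventually
      (isClosed_diagonal.isOpen_compl.mem_nhds (show (_, _) ∉ Set.diagonal ℝ from hne))
  obtain ⟨y, hy, g, rfl⟩ := mem_closure_iff_nhds.1 ((bohr G).denseRange_ι x) _ ho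
  exact hy ((congrFun hc.2 g).symm.trans (congrFun hf.2 g))

/-- `d_φ (g) = m_G (|φ - τ_g φ|)`. -/
noncomputable def hartmanDist (φ : G → ℂ) (g : G) : ℝ :=
  hartmanMean fun h => ‖φ h - φ (g + h)‖

/-- The filter `F(φ)` generated by the sets `{g | d_φ (g) < ε}`, `ε > 0`. -/
noncomputable def hartmanFilter (φ : G → ℂ) : Filter G :=
  ⨅ ε ∈ Set.Ioi (0 : ℝ), 𝓟 {g | hartmanDist φ g < ε}

end Hartman

/-!
For a Riemann integrable function `f` on a compactification `Y`, the function `d_f` is continuous,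
because translation is continuous in `L¹`, and subadditive. It therefore descends to a continuous
function on the compact group `Y / ker d_f` that vanishes only at `0`. By compactness such a function
determines the neighbourhoods of `0` (`nhds_zero_eq_comap_of_compact`), so that `Y / ker d_f` is first
countable, hence metrizable. If `f` realizes `φ`, then `d_φ = d_f ∘ ι_Y`: this is checked on `bG`,
where it is the definition of the mean, and transported by the covering map `bG → Y`, which preserves
Haar measure. Thus `F(φ)` is the filter of the metrizable compactification `Y / ker d_f`
(`Realizes.exists_quotient`). Conversely, the closures of the images of the members of a countable
basis of `U_X` form a basis of neighbourhoods of `0` in `X`, so a compactification with a countably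
generated filter is metrizable.

What remains is to find, in a metrizable compact group `X`, a set `M` with null boundary that no
nonzero translation preserves up to a null set (`exists_aperiodic`); then `ker d_{1_M}` is trivial and
the filter of `1_M ∘ ι_X` is that of `X`. If `0` is isolated, `M = {0}` will do. Otherwise let `f` be
the distance to `0` and let `M` be a union of shells `{s n < f < t n}` shrinking to `0`, with null
bounding spheres. The shells are chosen one after the other, so thin that the part of `M` in the
neighbourhood `{f < s n}` of `0` has measure less than the part of `M` in the translate of this
neighbourhood to any point in the closure of the `n`-th shell. So `M` is thinner at `0` than at any
other point of its closure, and an almost-everywhere period of `M` can only be `0`.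
-/

/-! ### Neighbourhoods of zero in compact groups -/

/-- In a compact space, a continuous real function that vanishes only at `0` generates the
neighbourhoods of `0`. -/
theorem nhds_zero_eq_comap_of_compact {X : Type*} [TopologicalSpace X] [CompactSpace X] [Zero X]
    {d : X → ℝ} (hd : Continuous d) (h0 : d 0 = 0) (h : ∀ x, d x = 0 → x = 0) :
    𝓝 (0 : X) = comap d (𝓝 0) := by
  refine le_antisymm ?_ (le_nhds_of_unique_clusterPt fun x hx => h x ?_)
  · rw [← map_le_iff_le_comap, ← h0]
    exact hd.continuousAt
  · have hc : ClusterPt (d x) (𝓝 (0 : ℝ)) :=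
      (hx.map hd.continuousAt tendsto_map).mono map_comap_le
    by_contra hne
    exact hc.ne (disjoint_nhds_nhds.2 hne).eq_bot

/-- The Birkhoff-Kakutani theorem for Hausdorff abelian groups. -/
theorem metrizableSpace_of_nhds_isCountablyGenerated {X : Type*} [AddCommGroup X]
    [TopologicalSpace X] [IsTopologicalAddGroup X] [T2Space X]
    (h : (𝓝 (0 : X)).IsCountablyGenerated) : MetrizableSpace X := by
  let _ := IsTopologicalAddGroup.rightUniformSpace X
  have : (uniformity X).IsCountablyGenerated := by
    rw [uniformity_eq_comap_nhds_zero']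
    infer_instance
  exact UniformSpace.metrizableSpace

/-! ### The function `d_f` and quotients of compactifications -/

namespace GroupCompactification

section

variable {G : Type u} [AddCommGroup G] [TopologicalSpace G]

instance (X : GroupCompactification.{u, v} G) : X.haar.Regular := by unfold haar; infer_instance

variable {X : GroupCompactification.{u, v} G}

theorem translationDist_nonneg (f : X → ℂ) (x : X) : 0 ≤ X.translationDist f x :=
  integral_nonneg fun _ => norm_nonneg _

@[simp] theorem translationDist_zero (f : X → ℂ) : X.translationDist f 0 = 0 := by
  simp [translationDist]

theorem RiemannIntegrable.translationDist_add_le {f : X → ℂ} (hf : X.RiemannIntegrable f)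
    (a b : X) : X.translationDist f (a + b) ≤ X.translationDist f a + X.translationDist f b := by
  have hi := hf.integrable
  have hab : ∀ c : X, Integrable (fun y => f (c + y)) X.haar := fun c => hi.comp_add_left c
  have hb : X.translationDist f a = ∫ y, ‖f (b + y) - f (a + (b + y))‖ ∂X.haar :=
    (integral_add_left_eq_self (μ := X.haar) (fun y => ‖f y - f (a + y)‖) b).symm
  have hbi : Integrable (fun y => ‖f (b + y) - f (a + (b + y))‖) X.haar :=
    ((hi.sub (hab a)).norm).comp_add_left b
  rw [hb, add_comm (∫ y, _ ∂_)]
  unfold translationDist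
  have hbi' : Integrable (fun y => ‖f y - f (b + y)‖) X.haar := (hi.sub (hab b)).norm
  rw [← integral_add hbi' hbi]
  refine integral_mono (hi.sub (hab (a + b))).norm (hbi'.add hbi) fun y => ?_
  simpa [add_assoc] using norm_sub_le_norm_sub_add_norm_sub (f y) (f (b + y)) (f (a + b + y))

/-- `d_f` is continuous because the group acts continuously on `L¹` by translations. -/
theorem RiemannIntegrable.continuous_translationDist {f : X → ℂ} (hf : X.RiemannIntegrable f) :
    Continuous (X.translationDist f) := by
  have hm : MemLp f 1 X.haar := memLp_one_iff_integrable.2 hf.integrable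
  have : Fact ((1 : ENNReal) ≠ ⊤) := ⟨by simp⟩
  have hc : Continuous fun x : X => ‖hm.toLp f - (DomAddAct.mk x +ᵥ hm.toLp f)‖ :=
    (continuous_const.sub (DomAddAct.continuous_mk.vadd continuous_const)).norm
  convert hc using 2 with x
  rw [DomAddAct.mk_vadd_toLp, ← MemLp.toLp_sub]
  exact (L1.norm_of_fun_eq_integral_norm (μ := X.haar)
    (hf.integrable.sub (hf.integrable.comp_add_left x))).symm

theorem RiemannIntegrable.norm_sub_translate {f : X → ℂ} (hf : X.RiemannIntegrable f) (x : X) :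
    X.RiemannIntegrable fun y => ‖f y - f (x + y)‖ := by
  obtain ⟨⟨C, hC⟩, h0⟩ := hf
  refine ⟨⟨C + C, fun y => ?_⟩, ?_⟩
  · simpa using (norm_sub_le _ _).trans (add_le_add (hC y) (hC (x + y)))
  · have h1 : X.haar ((x + ·) ⁻¹' {y | ¬ ContinuousAt f y}) = 0 := by
      rwa [measure_preimage_add]
    refine measure_mono_null (fun y hy => ?_) (measure_union_null h0 h1)
    by_contra hn
    simp only [Set.mem_union, Set.mem_ofPred_eq, Set.mem_preimage, not_or, not_not] at hn
    exact hy (hn.1.sub (ContinuousAt.comp (f := (x + ·)) hn.2 (by fun_prop))).norm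

/-- On `bG` the invariant mean is by definition the Haar integral of a realization, which gives
`d_φ = d_f ∘ ι_b`. -/
theorem hartmanDist_eq_translationDist {φ : G → ℂ} {f : bohr G → ℂ}
    (hf : (bohr G).Realizes f φ) (g : G) :
    hartmanDist φ g = (bohr G).translationDist f ((bohr G).ι g) := by
  refine hartmanMean_eq ⟨hf.1.norm_sub_translate _, ?_⟩
  ext h
  simp [hf.2]

/-- A covering of compactifications is onto: its range is compact, and dense since it contains the
image of `G`. -/
theorem surjective_of_comp_ι {Z : GroupCompactification.{u, w} G} {π : Z →ₜ+ X}
    (hπ : ∀ g, π (Z.ι g) = X.ι g) : Function.Surjective π := by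
  have hd : DenseRange π := X.denseRange_ι.mono (by
    rintro _ ⟨g, rfl⟩
    exact ⟨_, hπ g⟩)
  exact Set.range_eq_univ.1
    (((isCompact_range π.continuous_toFun).isClosed.closure_eq).symm.trans hd.closure_range)

theorem measurePreserving_of_comp_ι {Z : GroupCompactification.{u, w} G} {π : Z →ₜ+ X}
    (hπ : ∀ g, π (Z.ι g) = X.ι g) : MeasurePreserving π Z.haar X.haar :=
  AddMonoidHom.measurePreserving (f := (π : Z →+ X)) π.continuous_toFun (surjective_of_comp_ι hπ)
    (by simp)

theorem Realizes.comp {E : Type*} [NormedAddCommGroup E] {Z : GroupCompactification.{u, w} G}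
    {π : Z →ₜ+ X} (hπ : ∀ g, π (Z.ι g) = X.ι g) {f : X → E} {φ : G → E} (hf : X.Realizes f φ) :
    Z.Realizes (f ∘ π) φ := by
  refine ⟨⟨hf.1.1.imp fun C hC x => hC _, ?_⟩, ?_⟩
  · refine measure_mono_null (t := π ⁻¹' {x | ¬ ContinuousAt f x}) (fun x hx h => hx ?_) ?_
    · exact ContinuousAt.comp h π.continuous_toFun.continuousAt
    · exact (measurePreserving_of_comp_ι hπ).quasiMeasurePreserving.preimage_null hf.1.2
  · ext g
    simp [hf.2, hπ]

theorem translationDist_comp {Z : GroupCompactification.{u, w} G} {π : Z →ₜ+ X}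
    (hπ : ∀ g, π (Z.ι g) = X.ι g) {f : X → ℂ} (hf : X.RiemannIntegrable f) (z : Z) :
    Z.translationDist (f ∘ π) z = X.translationDist f (π z) := by
  have hm := measurePreserving_of_comp_ι hπ
  unfold translationDist
  rw [← hm.map_eq, integral_map hm.measurable.aemeasurable]
  · simp
  · rw [hm.map_eq]
    exact (hf.norm_sub_translate _).integrable.aestronglyMeasurable

theorem Realizes.isHartman {E : Type*} [NormedAddCommGroup E] {f : X → E} {φ : G → E}
    (hf : X.Realizes f φ) : IsHartman φ := by
  obtain ⟨π, hπ⟩ := exists_bohr_cover X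
  exact ⟨_, hf.comp hπ⟩

/-- The equality `d_φ = d_f ∘ ι_X` for a realization on any compactification. -/
theorem Realizes.hartmanDist_eq {f : X → ℂ} {φ : G → ℂ} (hf : X.Realizes f φ) (g : G) :
    hartmanDist φ g = X.translationDist f (X.ι g) := by
  obtain ⟨π, hπ⟩ := exists_bohr_cover X
  rw [hartmanDist_eq_translationDist (hf.comp hπ), translationDist_comp hπ hf.1, hπ]

theorem Realizes.hartmanFilter_eq {f : X → ℂ} {φ : G → ℂ} (hf : X.Realizes f φ) :
    hartmanFilter φ = comap X.ι (comap (X.translationDist f) (𝓝 0)) := by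
  rw [comap_comap, ((nhds_basis_abs_sub_lt (0 : ℝ)).comap _).eq_biInf]
  refine iInf_congr fun ε => iInf_congr fun _ => congrArg 𝓟 ?_
  ext g
  simp [hf.hartmanDist_eq, abs_of_nonneg (translationDist_nonneg _ _)]

/-- The quotient of a group compactification by a closed subgroup. -/
def quotient (X : GroupCompactification.{u, v} G) (N : AddSubgroup X)
    (hN : IsClosed (N : Set X)) : GroupCompactification.{u, v} G where
  carrier := X ⧸ N
  str :=
    { t2Space := haveI := hN; inferInstance
      toHom :=
        { toFun g := QuotientAddGroup.mk (X.ι g)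
          map_zero' := by simp
          map_add' a b := by simp
          continuous_toFun := continuous_quotient_mk'.comp X.ι.continuous_toFun }
      denseRange := (QuotientAddGroup.mk_surjective (s := N)).denseRange.comp X.denseRange_ι
        continuous_quotient_mk' }

theorem RiemannIntegrable.isClosed_kerTranslationDist {f : X → ℂ} (hf : X.RiemannIntegrable f) :
    IsClosed (X.kerTranslationDist f hf : Set X) :=
  isClosed_singleton.preimage hf.continuous_translationDist

/-- The neighbourhoods of `0` in `X / ker d_f` are generated by the function that `d_f` induces on the
quotient; pulled back to `X` they are generated by `d_f` itself. -/
theorem RiemannIntegrable.nhds_zero_quotient {f : X → ℂ} (hf : X.RiemannIntegrable f) :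
    (𝓝 (0 : X ⧸ X.kerTranslationDist f hf)).IsCountablyGenerated ∧
      comap (QuotientAddGroup.mk : X → X ⧸ X.kerTranslationDist f hf) (𝓝 0) =
        comap (X.translationDist f) (𝓝 0) := by
  have hle : ∀ a b : X, -a + b ∈ X.kerTranslationDist f hf →
      X.translationDist f b ≤ X.translationDist f a := fun a b h => by
    have := hf.translationDist_add_le a (-a + b)
    rw [add_neg_cancel_left] at this
    rwa [show X.translationDist f (-a + b) = 0 from h, add_zero] at this
  let d : X ⧸ X.kerTranslationDist f hf → ℝ := Quotient.lift (X.translationDist f) fun a b h => by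
    have h' := QuotientAddGroup.leftRel_apply.1 h
    exact le_antisymm (hle _ _ (by simpa using neg_mem h')) (hle _ _ h')
  have hd : Continuous d := hf.continuous_translationDist.quotient_lift _
  have hn : 𝓝 (0 : X ⧸ X.kerTranslationDist f hf) = comap d (𝓝 0) := by
    refine nhds_zero_eq_comap_of_compact hd (translationDist_zero f) fun x => ?_
    refine QuotientAddGroup.induction_on x fun y hy => ?_
    exact (QuotientAddGroup.eq_zero_iff y).2 hy
  refine ⟨hn ▸ inferInstance, ?_⟩
  rw [hn, comap_comap]
  rfl

/-- The filter of a function realized by `f` on `X` is that of the metrizable compactification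
`X / ker d_f`. -/
theorem Realizes.exists_quotient {f : X → ℂ} {φ : G → ℂ} (hf : X.Realizes f φ) :
    ∃ Z : GroupCompactification.{u, v} G, MetrizableSpace Z ∧ hartmanFilter φ = Z.nhdsFilter ∧
      ∃ e : Z ≃ₜ+ (X ⧸ kerTranslationDist f hf.1),
        ∀ g : G, e (Z.ι g) = QuotientAddGroup.mk (X.ι g) := by
  obtain ⟨h1, h2⟩ := hf.1.nhds_zero_quotient
  let Z := X.quotient _ hf.1.isClosed_kerTranslationDist
  have hZ : (𝓝 (0 : Z)).IsCountablyGenerated := h1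
  refine ⟨Z, metrizableSpace_of_nhds_isCountablyGenerated hZ, ?_,
    ContinuousAddEquiv.refl _, fun _ => rfl⟩
  rw [hf.hartmanFilter_eq, ← h2, comap_comap]
  rfl

/-- If `V n` is a countable basis of the filter of `X`, then the closures of the sets `ι_X (V n)` form a
basis of neighbourhoods of `0` in `X`. -/
theorem metrizableSpace_of_nhdsFilter_isCountablyGenerated (X : GroupCompactification.{u, v} G)
    (h : X.nhdsFilter.IsCountablyGenerated) : MetrizableSpace X := by
  apply metrizableSpace_of_nhds_isCountablyGenerated
  obtain ⟨V, hV⟩ := X.nhdsFilter.exists_antitone_basis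
  have hb : (𝓝 (0 : X)).HasBasis (fun _ : ℕ => True) fun n => closure (X.ι '' V n) := by
    refine ⟨fun t => ⟨fun ht => ?_, ?_⟩⟩
    · obtain ⟨W, hW, hWc, hWt⟩ := exists_mem_nhds_isClosed_subset ht
      obtain ⟨n, -, hn⟩ := hV.1.mem_iff.1 (preimage_mem_comap hW : X.ι ⁻¹' W ∈ X.nhdsFilter)
      exact ⟨n, trivial, (closure_minimal (Set.image_subset_iff.2 hn) hWc).trans hWt⟩
    · rintro ⟨n, -, hn⟩
      obtain ⟨U, hU, hUV⟩ := mem_comap.1 (hV.1.mem_of_mem (i := n) trivial : V n ∈ X.nhdsFilter)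
      obtain ⟨O, hOU, hO, h0⟩ := mem_nhds_iff.1 hU
      refine mem_of_superset (hO.mem_nhds h0) (subset_trans ?_ hn)
      refine (X.denseRange_ι.open_subset_closure_inter hO).trans (closure_mono ?_)
      rintro _ ⟨hx, g, rfl⟩
      exact ⟨g, hUV (hOU hx), rfl⟩
  exact hb.isCountablyGenerated

end

end GroupCompactification

/-! ### A set with null boundary and without periods -/

/-- Only countably many of the disjoint level sets have positive measure. -/
theorem exists_null_level {X : Type*} [TopologicalSpace X] [MeasurableSpace X]
    [OpensMeasurableSpace X] {μ : Measure X} [SFinite μ] {f : X → ℝ}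
    (hf : Continuous f) {a b : ℝ} (hab : a < b) :
    ∃ r ∈ Set.Ioo a b, μ (f ⁻¹' {r}) = 0 := by
  obtain ⟨r, hr, hr'⟩ := (Set.Countable.dense_compl ℝ
    (Measure.countable_meas_level_set_pos (μ := μ) hf.measurable)).exists_between hab
  exact ⟨r, hr', nonpos_iff_eq_zero.1 (not_lt.1 hr)⟩

theorem tendsto_measure_preimage_Ioo_zero {X : Type*} [TopologicalSpace X] [MeasurableSpace X]
    [OpensMeasurableSpace X] {μ : Measure X} [IsFiniteMeasure μ] {f : X → ℝ}
    (hf : Continuous f) :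
    Tendsto (fun t => μ (f ⁻¹' Set.Ioo 0 t)) (𝓝[>] 0) (𝓝 0) := by
  have h := tendsto_measure_biInter_gt (μ := μ) (a := (0 : ℝ)) (s := fun t => f ⁻¹' Set.Ioo 0 t)
    (fun r _ => (hf.measurable measurableSet_Ioo).nullMeasurableSet)
    (fun i j _ hij => Set.preimage_mono (Set.Ioo_subset_Ioo_right hij)) ⟨1, one_pos, by simp⟩
  suffices he : ⋂ t > (0 : ℝ), f ⁻¹' Set.Ioo 0 t = ∅ by
    rwa [he, measure_empty] at h
  refine Set.eq_empty_of_forall_notMem fun x hx => ?_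
  simp only [Set.mem_iInter] at hx
  have h1 := (hx 1 one_pos).1
  exact lt_irrefl _ (hx (f x) h1).2

section Aperiodic

variable {X : Type*} [AddCommGroup X] [TopologicalSpace X] [MeasurableSpace X]
  {μ : Measure X}

/-- The pair `p = (s, t)` bounds a shell: the open set `{x | s < f x < t}`, with `0 < s < t`, is nonempty
and its bounding level sets `{f = s}` and `{f = t}` are null. -/
structure IsShell (μ : Measure X) (f : X → ℝ) (p : ℝ × ℝ) : Prop where
  pos : 0 < p.1
  lt : p.1 < p.2
  nonempty : (f ⁻¹' Set.Ioo p.1 p.2).Nonempty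
  null_fst : μ (f ⁻¹' {p.1}) = 0
  null_snd : μ (f ⁻¹' {p.2}) = 0

theorem exists_isShell [OpensMeasurableSpace X] [(𝓝[≠] (0 : X)).NeBot] [SFinite μ] {f : X → ℝ}
    (hf : Continuous f) (h0 : f 0 = 0) (hpos : ∀ x, x ≠ 0 → 0 < f x)
    {r : ℝ} (hr : 0 < r) :
    ∃ p, IsShell μ f p ∧ p.2 < r := by
  obtain ⟨t, ⟨ht0, htr⟩, ht⟩ := exists_null_level (μ := μ) hf hr
  have hev : ∀ᶠ x in 𝓝[≠] (0 : X), f x < t ∧ x ≠ 0 :=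
    (eventually_nhdsWithin_of_eventually_nhds
      (hf.continuousAt.eventually_lt_const (by rwa [h0]))).and eventually_mem_nhdsWithin
  obtain ⟨c, hct, hc⟩ := hev.exists
  obtain ⟨s, ⟨hs0, hsc⟩, hs⟩ := exists_null_level (μ := μ) hf (hpos c hc)
  exact ⟨(s, t), ⟨hs0, hsc.trans hct, ⟨c, hsc, hct⟩, hs, ht⟩, htr⟩

variable [IsTopologicalAddGroup X]

/-- An open set `B` has measure bounded away from zero in the translates of a neighbourhood of `0` to
the points of the closure of `B`. -/
theorem exists_pos_le_measure_inter_translate [CompactSpace X] [μ.IsOpenPosMeasure] {B V : Set X}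
    (hB : IsOpen B) (hV : V ∈ 𝓝 (0 : X)) :
    ∃ δ : ENNReal, 0 < δ ∧ ∀ x ∈ closure B, δ ≤ μ (B ∩ {y | y - x ∈ V}) := by
  obtain ⟨W, hW, hWV⟩ := exists_nhds_half_neg hV
  have hU : ∀ y ∈ closure B, {z | z - y ∈ interior W} ∈ 𝓝 y := fun y _ =>
    (isOpen_interior.preimage (continuous_id.sub continuous_const)).mem_nhds
      (by simpa using mem_interior_iff_mem_nhds.2 hW)
  obtain ⟨t, ht, hcov⟩ := isClosed_closure.isCompact.elim_nhds_subcover _ hU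
  refine ⟨t.inf fun y => μ (B ∩ {z | z - y ∈ interior W}), ?_, fun x hx => ?_⟩
  · refine (Finset.lt_inf_iff ENNReal.zero_lt_top).2 fun y hy => ?_
    have ho : IsOpen {z | z - y ∈ interior W} :=
      isOpen_interior.preimage (continuous_id.sub continuous_const)
    refine (hB.inter ho).measure_pos μ ?_
    rw [Set.inter_comm]
    exact mem_closure_iff_nhds.1 (ht y hy) _ (hU y (ht y hy))
  · obtain ⟨y, hy, hxy⟩ := Set.mem_iUnion₂.1 (hcov hx)
    refine (Finset.inf_le hy).trans (measure_mono fun z hz => ⟨hz.1, ?_⟩)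
    simpa using hWV _ (interior_subset hz.2) _ (interior_subset hxy)

/-- If `h` is an almost-everywhere period of `M`, then `M` is equally thick around `h` and `0`. -/
theorem measure_inter_translate_eq [BorelSpace X] [μ.IsAddLeftInvariant] {M : Set X} {h : X}
    (hh : ∀ᵐ y ∂μ, y ∈ M ↔ h + y ∈ M) (V : Set X) :
    μ (M ∩ {y | y - h ∈ V}) = μ (M ∩ V) := by
  rw [← measure_preimage_add μ h]
  refine measure_congr ?_
  filter_upwards [hh] with y hy
  simp only [Set.preimage, eq_iff_iff]
  change (h + y ∈ M ∧ h + y - h ∈ V) ↔ (y ∈ M ∧ y ∈ V)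
  rw [hy, add_sub_cancel_left]

variable [CompactSpace X] [BorelSpace X]

/-- After a given shell there is another one, closer to `0`, such that all of `{0 < f}` inside its outer
sphere has smaller measure than the part of the given shell in the translate of `{f < s}` to any point
in the closure of that shell. -/
theorem IsShell.exists_next [(𝓝[≠] (0 : X)).NeBot] [IsFiniteMeasure μ] [μ.IsOpenPosMeasure]
    {f : X → ℝ} (hf : Continuous f) (h0 : f 0 = 0) (hpos : ∀ x, x ≠ 0 → 0 < f x)
    {p : ℝ × ℝ} (hp : IsShell μ f p) :
    ∃ q, IsShell μ f q ∧ q.2 < p.1 / 2 ∧ ∀ x ∈ closure (f ⁻¹' Set.Ioo p.1 p.2),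
      μ (f ⁻¹' Set.Ioo 0 q.2) < μ (f ⁻¹' Set.Ioo p.1 p.2 ∩ {y | f (y - x) < p.1}) := by
  have hV : {x | f x < p.1} ∈ 𝓝 (0 : X) :=
    hf.continuousAt.eventually_lt_const (by rw [h0]; exact hp.pos)
  obtain ⟨δ, hδ, hle⟩ :=
    exists_pos_le_measure_inter_translate (μ := μ) (isOpen_Ioo.preimage hf) hV
  have hev : ∀ᶠ t in 𝓝[>] (0 : ℝ), μ (f ⁻¹' Set.Ioo 0 t) < δ ∧ t < p.1 / 2 ∧ 0 < t :=
    ((tendsto_measure_preimage_Ioo_zero hf).eventually_lt_const hδ).and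
      ((eventually_nhdsWithin_of_eventually_nhds (eventually_lt_nhds (half_pos hp.pos))).and
        eventually_mem_nhdsWithin)
  obtain ⟨r, hr, hrp, hr0⟩ := hev.exists
  obtain ⟨q, hq, hqr⟩ := exists_isShell (μ := μ) hf h0 hpos hr0
  refine ⟨q, hq, hqr.trans hrp, fun x hx => ?_⟩
  exact ((measure_mono (Set.preimage_mono (Set.Ioo_subset_Ioo_right hqr.le))).trans_lt hr).trans_le
    (hle x hx)

theorem exists_seq_isShell [(𝓝[≠] (0 : X)).NeBot] [IsFiniteMeasure μ] [μ.IsOpenPosMeasure]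
    {f : X → ℝ} (hf : Continuous f) (h0 : f 0 = 0) (hpos : ∀ x, x ≠ 0 → 0 < f x) :
    ∃ p : ℕ → ℝ × ℝ, ∀ n, IsShell μ f (p n) ∧ (p (n + 1)).2 < (p n).1 / 2 ∧
      ∀ x ∈ closure (f ⁻¹' Set.Ioo (p n).1 (p n).2), μ (f ⁻¹' Set.Ioo 0 (p (n + 1)).2) <
        μ (f ⁻¹' Set.Ioo (p n).1 (p n).2 ∩ {y | f (y - x) < (p n).1}) := by
  obtain ⟨p₀, hp₀, -⟩ := exists_isShell (μ := μ) hf h0 hpos one_pos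
  choose next h1 h2 h3 using fun p : {p // IsShell μ f p} => p.2.exists_next hf h0 hpos
  let P : ℕ → {p // IsShell μ f p} := fun n => (fun p => ⟨next p, h1 p⟩)^[n] ⟨p₀, hp₀⟩
  have hP : ∀ n, (P (n + 1)).1 = next (P n) := fun n => by
    simp only [P, Function.iterate_succ_apply']
  refine ⟨fun n => (P n).1, fun n => ⟨(P n).2, ?_⟩⟩
  simp only [hP]
  exact ⟨h2 _, h3 _⟩

variable [T2Space X]

/-- The union of a rapidly shrinking sequence of shells around a non-isolated `0` has null boundary and
no nonzero almost-everywhere period, because it is thinner at `0` than elsewhere in its closure. -/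
theorem exists_aperiodic_of_gauge [(𝓝[≠] (0 : X)).NeBot] [μ.IsAddHaarMeasure]
    {f : X → ℝ} (hf : Continuous f) (h0 : f 0 = 0) (hpos : ∀ x, x ≠ 0 → 0 < f x) :
    ∃ M : Set X, μ (frontier M) = 0 ∧ ∀ h, (∀ᵐ y ∂μ, y ∈ M ↔ h + y ∈ M) → h = 0 := by
  obtain ⟨p, hp⟩ := exists_seq_isShell (μ := μ) hf h0 hpos
  have hfn : ∀ x, 0 ≤ f x := fun x => by
    rcases eq_or_ne x 0 with rfl | hx
    exacts [h0.ge, (hpos x hx).le]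
  set B : ℕ → Set X := fun n => f ⁻¹' Set.Ioo (p n).1 (p n).2
  have hBo : ∀ n, IsOpen (B n) := fun n => isOpen_Ioo.preimage hf
  have hs : Antitone fun n => (p n).1 := antitone_nat_of_succ_le fun n => by
    linarith [(hp (n + 1)).1.lt, (hp n).2.1, (hp n).1.pos]
  have ht : Antitone fun n => (p n).2 := antitone_nat_of_succ_le fun n => by
    linarith [(hp n).1.lt, (hp n).2.1, (hp n).1.pos]
  have ht0 : ∀ r > 0, ∃ n, (p n).2 < r := fun r hr => by
    have hle : ∀ n, (p n).2 ≤ (1 / 2) ^ n * (p 0).2 := fun n => by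
      induction n with
      | zero => simp
      | succ n ih =>
        rw [pow_succ]
        linarith [(hp n).1.lt, (hp n).2.1]
    have hl : Tendsto (fun n : ℕ => (1 / 2 : ℝ) ^ n * (p 0).2) atTop (𝓝 (0 * (p 0).2)) :=
      (tendsto_pow_atTop_nhds_zero_of_lt_one (by norm_num) (by norm_num)).mul_const _
    rw [zero_mul] at hl
    obtain ⟨n, hn⟩ := (hl.eventually_lt_const hr).exists
    exact ⟨n, (hle n).trans_lt hn⟩
  -- Away from `0` only finitely many shells matter for the closure.
  have hcl : ∀ x ∈ closure (⋃ n, B n), 0 < f x → ∃ n, x ∈ closure (B n) := fun x hx hx0 => by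
    obtain ⟨N, hN⟩ := ht0 _ hx0
    have hsub : (⋃ n, B n) ⊆ (⋃ n ∈ Set.Iio N, closure (B n)) ∪ f ⁻¹' Set.Iic (p N).2 := by
      refine Set.iUnion_subset fun n y hy => ?_
      rcases lt_or_ge n N with h | h
      · exact Or.inl (Set.mem_biUnion h (subset_closure hy))
      · exact Or.inr (hy.2.le.trans (ht h))
    have hc := closure_minimal hsub (((Set.finite_Iio N).isClosed_biUnion
      fun n _ => isClosed_closure).union (isClosed_Iic.preimage hf)) hx
    rcases hc with hc | hc
    · obtain ⟨n, -, hn⟩ := Set.mem_iUnion₂.1 hc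
      exact ⟨n, hn⟩
    · exact absurd hN (not_lt.2 hc)
  refine ⟨⋃ n, B n, ?_, fun h hh => ?_⟩
  · have hsub : frontier (⋃ n, B n) ⊆
        {0} ∪ ⋃ n, (f ⁻¹' {(p n).1} ∪ f ⁻¹' {(p n).2}) := by
      intro x hx
      rw [(isOpen_iUnion hBo).frontier_eq] at hx
      by_cases hx0 : x = 0
      · exact Or.inl hx0
      · obtain ⟨n, hn⟩ := hcl x hx.1 (hpos x hx0)
        refine Or.inr (Set.mem_iUnion.2 ⟨n, ?_⟩)
        have h1 : x ∈ f ⁻¹' Set.Icc (p n).1 (p n).2 :=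
          closure_minimal (Set.preimage_mono Set.Ioo_subset_Icc_self)
            (isClosed_Icc.preimage hf) hn
        have h2 : ¬ ((p n).1 < f x ∧ f x < (p n).2) := fun h => hx.2 (Set.mem_iUnion.2 ⟨n, h⟩)
        rcases h1.1.eq_or_lt with h | h
        · exact Or.inl h.symm
        · exact Or.inr (le_antisymm h1.2 (not_lt.1 fun h' => h2 ⟨h, h'⟩))
    refine measure_mono_null hsub (measure_union_null (measure_singleton _) ?_)
    exact measure_iUnion_null fun n => measure_union_null (hp n).1.null_fst (hp n).1.null_snd
  · by_contra hne
    have key : ∀ r, μ ((⋃ n, B n) ∩ {y | f (y - h) < r}) = μ ((⋃ n, B n) ∩ {y | f y < r}) :=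
      fun r => measure_inter_translate_eq hh {y | f y < r}
    by_cases hM : h ∈ closure (⋃ n, B n)
    -- Around a point in the closure of the `n`-th shell, `M` is thicker than around `0`.
    · obtain ⟨n, hn⟩ := hcl h hM (hpos h hne)
      refine lt_irrefl _ (((hp n).2.2 h hn).trans_le ?_)
      calc _ ≤ μ ((⋃ n, B n) ∩ {y | f (y - h) < (p n).1}) :=
            measure_mono (Set.inter_subset_inter_left _ (Set.subset_iUnion B n))
        _ = μ ((⋃ n, B n) ∩ {y | f y < (p n).1}) := key _
        _ ≤ μ (f ⁻¹' Set.Ioo 0 (p (n + 1)).2) := measure_mono ?_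
      rintro y ⟨hy, hyn⟩
      obtain ⟨k, hk⟩ := Set.mem_iUnion.1 hy
      have hnk : n < k := not_le.1 fun hkn => (hk.1.trans hyn).not_ge (hs hkn)
      exact ⟨(hp k).1.pos.trans hk.1, hk.2.trans_le (ht hnk)⟩
    -- Around a point outside its closure `M` has measure zero, which is not the case around `0`.
    · have hV : {z | h + z ∉ closure (⋃ n, B n)} ∈ 𝓝 (0 : X) :=
        (isClosed_closure.isOpen_compl.preimage (continuous_const.add continuous_id)).mem_nhds
          (by simpa using hM)
      rw [nhds_zero_eq_comap_of_compact hf h0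
        fun x hx => by_contra fun hne => (hpos x hne).ne' hx] at hV
      obtain ⟨r, hr, hrV⟩ := ((nhds_basis_abs_sub_lt (0 : ℝ)).comap f).mem_iff.1 hV
      have hz : (⋃ n, B n) ∩ {y | f (y - h) < r} = ∅ := by
        refine Set.eq_empty_of_forall_notMem fun y hy => ?_
        have := @hrV (y - h) (by simpa [abs_of_nonneg (hfn _)] using hy.2)
        simp only [Set.mem_ofPred_eq, add_sub_cancel] at this
        exact this (subset_closure hy.1)
      obtain ⟨n, hn⟩ := ht0 r hr
      have h1 : 0 < μ (B n) := (hBo n).measure_pos μ (hp n).1.nonempty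
      have h2 : μ (B n) ≤ μ ((⋃ n, B n) ∩ {y | f y < r}) :=
        measure_mono fun y hy => ⟨Set.mem_iUnion.2 ⟨n, hy⟩, hy.2.trans hn⟩
      rw [← key, hz, measure_empty] at h2
      exact h1.not_ge h2

/-- A metrizable compact abelian group contains a set with null boundary that differs from each of its
nonzero translates by a set of positive measure. -/
theorem exists_aperiodic [MetrizableSpace X] (μ : Measure X) [μ.IsAddHaarMeasure] :
    ∃ M : Set X, μ (frontier M) = 0 ∧ ∀ h, (∀ᵐ y ∂μ, y ∈ M ↔ h + y ∈ M) → h = 0 := by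
  rcases (𝓝[≠] (0 : X)).eq_or_neBot with hb | hb
  · have ho : IsOpen ({0} : Set X) := (isOpen_singleton_iff_punctured_nhds 0).2 hb
    refine ⟨{0}, ?_, fun h hh => ?_⟩
    · rw [IsClopen.frontier_eq ⟨isClosed_singleton, ho⟩, measure_empty]
    · by_contra hne
      refine (ho.measure_pos μ (Set.singleton_nonempty 0)).ne' (measure_mono_null ?_ (ae_iff.1 hh))
      rintro _ rfl
      simpa using hne
  · let _ := metrizableSpaceMetric X
    exact exists_aperiodic_of_gauge (f := fun x => dist x 0) (by fun_prop) (by simp)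
      fun x hx => dist_pos.2 hx

end Aperiodic

/-! ### Filters of Hartman measurable sets -/

namespace GroupCompactification

theorem realizes_indicator_preimage {G : Type u} [AddCommGroup G] [TopologicalSpace G]
    (X : GroupCompactification.{u, v} G) {M : Set X} (hM : X.haar (frontier M) = 0) :
    X.Realizes (M.indicator (1 : X → ℂ)) ((X.ι ⁻¹' M).indicator 1) := by
  refine ⟨⟨⟨1, fun x => ?_⟩, measure_mono_null (fun x hx => ?_) hM⟩,
    funext fun g => Set.indicator_comp_right X.ι (g := (1 : X → ℂ))⟩
  · simpa using norm_indicator_le_norm_self (1 : X → ℂ) x (s := M)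
  · by_contra hn
    exact hx (continuousOn_const.continuousAt_indicator hn)

/-- Every metrizable compactification is recovered from the trace on `G` of a set without periods. -/
theorem exists_isHartmanSet_hartmanFilter_eq {G : Type u} [AddCommGroup G] [TopologicalSpace G]
    (X : GroupCompactification.{u, v} G) [MetrizableSpace X] :
    ∃ A : Set G, IsHartmanSet A ∧ hartmanFilter (A.indicator 1) = X.nhdsFilter := by
  obtain ⟨M, hM, hper⟩ := exists_aperiodic X.haar
  have hreal := X.realizes_indicator_preimage hM
  have hR := hreal.1
  refine ⟨X.ι ⁻¹' M, ?_, ?_⟩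
  · obtain ⟨π, hπ⟩ := exists_bohr_cover X
    refine ⟨π ⁻¹' M, measure_mono_null (π.continuous_toFun.frontier_preimage_subset M)
      ((measurePreserving_of_comp_ι hπ).quasiMeasurePreserving.preimage_null hM), ?_⟩
    ext g
    simp [hπ]
  · rw [hreal.hartmanFilter_eq, nhdsFilter, ← nhds_zero_eq_comap_of_compact
      hR.continuous_translationDist (translationDist_zero _) fun x hx => hper x ?_]
    have hae := (integral_eq_zero_iff_of_nonneg (fun _ => norm_nonneg _)
      (hR.norm_sub_translate x).integrable).1 hx
    filter_upwards [hae] with y hy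
    simp only [Pi.zero_apply, norm_eq_zero, sub_eq_zero] at hy
    by_cases h1 : y ∈ M <;> by_cases h2 : x + y ∈ M <;> simp_all

end GroupCompactification

theorem mainTheorem7 (G : Type u) [AddCommGroup G] [TopologicalSpace G] [IsTopologicalAddGroup G]
    [LocallyCompactSpace G] [T2Space G] [SeparableSpace (PontryaginDual (Multiplicative G))] :
    -- the filters of Hartman measurable functions are exactly those of metrizable compactifications
    {F : Filter G | ∃ φ : G → ℂ, IsHartman φ ∧ hartmanFilter φ = F} =
      {F : Filter G | ∃ X : GroupCompactification.{u, u} G, MetrizableSpace X ∧ X.nhdsFilter = F} ∧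
    -- no such filter comes from a compactification that is not metrizable
    (∀ φ : G → ℂ, IsHartman φ → ∀ X : GroupCompactification.{u, v} G,
      hartmanFilter φ = X.nhdsFilter → MetrizableSpace X) ∧
    -- every metrizable compactification is obtained from a Hartman measurable set
    (∀ X : GroupCompactification.{u, v} G, MetrizableSpace X →
      ∃ A : Set G, IsHartmanSet A ∧ hartmanFilter (A.indicator 1) = X.nhdsFilter) ∧
    -- for a realization `f` of `φ` on `bG` one may take `X ≅ bG / ker d_f`
    (∀ (φ : G → ℂ) (f : GroupCompactification.bohr G → ℂ)
      (hf : (GroupCompactification.bohr G).Realizes f φ),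
      ∃ X : GroupCompactification.{u, u} G, MetrizableSpace X ∧ hartmanFilter φ = X.nhdsFilter ∧
        ∃ e : X ≃ₜ+ (GroupCompactification.bohr G ⧸
            GroupCompactification.kerTranslationDist f hf.1),
          ∀ g : G, e (X.ι g) = QuotientAddGroup.mk ((GroupCompactification.bohr G).ι g)) ∧
    -- and likewise for a realization on any group compactification `Y`
    (∀ (φ : G → ℂ) (Y : GroupCompactification.{u, v} G) (f : Y → ℂ) (hf : Y.Realizes f φ),
      IsHartman φ ∧
      ∃ X : GroupCompactification.{u, v} G, MetrizableSpace X ∧ hartmanFilter φ = X.nhdsFilter ∧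
        ∃ e : X ≃ₜ+ (Y ⧸ GroupCompactification.kerTranslationDist f hf.1),
          ∀ g : G, e (X.ι g) = QuotientAddGroup.mk (Y.ι g)) := by
  refine ⟨?_, ?_, fun X hX => X.exists_isHartmanSet_hartmanFilter_eq,
    fun φ f hf => hf.exists_quotient, fun φ Y f hf => ⟨hf.isHartman, hf.exists_quotient⟩⟩
  · ext F
    constructor
    · rintro ⟨φ, ⟨f, hf⟩, rfl⟩
      obtain ⟨X, hX, hF, -⟩ := hf.exists_quotient
      exact ⟨X, hX, hF.symm⟩
    · rintro ⟨X, hX, rfl⟩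
      obtain ⟨A, ⟨M, hM, rfl⟩, hF⟩ := X.exists_isHartmanSet_hartmanFilter_eq
      exact ⟨_, ((GroupCompactification.bohr G).realizes_indicator_preimage hM).isHartman, hF⟩
  · rintro φ ⟨f, hf⟩ X hX
    obtain ⟨Z, hZ, hF, -⟩ := hf.exists_quotient
    apply X.metrizableSpace_of_nhdsFilter_isCountablyGenerated
    rw [← hX, hF, GroupCompactification.nhdsFilter]
    infer_instance
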